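/- **Setting.** Let $p$ be an odd prime and $\mathbb{Z}_p=\mathbb{Z}/p\mathbb{Z}$. For a diagram $D$ of a knot (on the sphere; one may equally use the plane), let $\mathcal{R}(D)$ be its set of regions, i.e. of connected components of the complement of the underlying curve. At each crossing, label the four surrounding regions $x_1,x_2,x_3,x_4$ so that $x_2$ is separated from $x_1$ by the under-strand, $x_3$ is separated from $x_1$ by the over-strand, and $x_4$ is opposite to $x_1$. A *Dehn $p$-coloring* of $D$ is a map $C:\mathcal{R}(D)\to\mathbb{Z}_p$ such that $C(x_1)+C(x_3)=C(x_2)+C(x_4)$ at every crossing. It is *trivial* if at every crossing $C(x_1)=C(x_4)$ and $C(x_2)=C(x_3)$, and *nontrivial* otherwise. A knot $K$ is *Dehn $p$-colorable* if some diagram of $K$ has a nontrivial Dehn $p$-coloring. In this case put $$\mathrm{mincol}^{\mathrm{Dehn}}_p(K)=\min\{\#\,\mathrm{Im}\,C \;:\; C \text{ is a nontrivial Dehn } p\text{-coloring of a diagram } D \text{ of } K\}.$$ **Theorem.** Let $p$ be an odd prime number. For any Dehn $p$-colorable knot $K$, $$\mathrm{mincol}^{\mathrm{Dehn}}_p(K)\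 \ge\ \log_2 p+1,$$ that is, $$\mathrm{mincol}^{\mathrm{Dehn}}_p(K)\ \ge\ \lfloor\log_2 p\rfloor+2 .$$ -/

import Mathlib

/-!
Knots are treated through their diagrams: a knot is a class of knot diagrams modulo Reidemeister
moves (and reversal of the auxiliary orientation). A knot diagram on the sphere is encoded by its
signed Gauss code: travel once along the oriented curve and record, at each passage through a
crossing, the name of the crossing, whether one is on the over- or under-strand, and the sign of
the crossing. The code with no entries is the diagram without crossings (a simple closed curve).
-/

/-- One passage of the oriented curve through a crossing. -/
@[ext] structure Passage where
  crossing : ℕ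
  isOver : Bool
  sign : ℤˣ
deriving DecidableEq

/-- The other passage through the same crossing. -/
def Passage.partner (x : Passage) : Passage := ⟨x.crossing, !x.isOver, x.sign⟩

/-- Renaming of crossings. -/
def Passage.rename (f : ℕ → ℕ) (x : Passage) : Passage := ⟨f x.crossing, x.isOver, x.sign⟩

/-- A word is a signed Gauss code if every crossing that occurs in it is passed exactly twice,
once over and once under, with the same sign. -/
structure IsGaussCode (w : List Passage) : Prop where
  nodup : w.Nodup
  partner_mem : ∀ x ∈ w, x.partner ∈ w
  eq_or_eq_partner : ∀ x ∈ w, ∀ y ∈ w, y.crossing = x.crossing → y = x ∨ y = x.partner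

/-- The semiarcs of the diagram: the pieces of the curve between consecutive passages.
A diagram without crossings has one semiarc, the whole curve. -/
abbrev Semiarc (w : List Passage) : Type := Fin (max 1 w.length)

/-- The semiarc along which the curve arrives at the `i`-th passage. -/
def inArc (w : List Passage) (i : Fin w.length) : Semiarc w :=
  ⟨i, lt_of_lt_of_le i.isLt (le_max_right 1 w.length)⟩

/-- The semiarc along which the curve leaves the `i`-th passage. -/
def outArc (w : List Passage) (i : Fin w.length) : Semiarc w :=
  ⟨(i + 1) % max 1 w.length, Nat.mod_lt _ (lt_of_lt_of_le one_pos (le_max_left 1 w.length))⟩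

/-- The two sides of a semiarc, as seen when travelling along the curve. -/
inductive Side
  | left
  | right
deriving DecidableEq

/-- The `i`-th passage is the over-passage and the `j`-th passage is the under-passage of
one and the same crossing. -/
def IsCrossing (w : List Passage) (i j : Fin w.length) : Prop :=
  (w.get i).isOver = true ∧ w.get j = (w.get i).partner

/-- At a crossing with over-passage `i` and under-passage `j`, each of the four quadrants touches
one side of a semiarc of the over-strand and one side of a semiarc of the under-strand.
The quadrants are named from the point of view of a traveller on the over-strand. At a positive
crossing the under-strand runs from the right to the left of the over-strand, at a negative
crossing from the left to the right. -/
inductive SameQuadrant (w : List Passage) : Semiarc w × Side → Semiarc w × Side → Prop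
  | frontLeft (i j : Fin w.length) (h : IsCrossing w i j) :
      SameQuadrant w (outArc w i, .left)
        (if (w.get i).sign = 1 then (outArc w j, .right) else (inArc w j, .left))
  | frontRight (i j : Fin w.length) (h : IsCrossing w i j) :
      SameQuadrant w (outArc w i, .right)
        (if (w.get i).sign = 1 then (inArc w j, .right) else (outArc w j, .left))
  | backLeft (i j : Fin w.length) (h : IsCrossing w i j) :
      SameQuadrant w (inArc w i, .left)
        (if (w.get i).sign = 1 then (outArc w j, .left) else (inArc w j, .right))
  | backRight (i j : Fin w.length) (h : IsCrossing w i j) :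
      SameQuadrant w (inArc w i, .right)
        (if (w.get i).sign = 1 then (inArc w j, .left) else (outArc w j, .right))

/-- The regions of the diagram: sides of semiarcs, identified when they meet the same quadrant
of a crossing. -/
def Region (w : List Passage) : Type := Quot (SameQuadrant w)

/-- The region that lies along a given side of a given semiarc. -/
def Region.beside {w : List Passage} (e : Semiarc w) (s : Side) : Region w := Quot.mk _ (e, s)

/-- A knot diagram: a signed Gauss code which is realized on the sphere. A connected curve with
`n` crossings fills a closed oriented surface of Euler characteristic `F - n`, where `F` is the
number of regions, so the surface is the sphere exactly if there are `n + 2` regions. -/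
structure KnotDiagram where
  code : List Passage
  isGaussCode : IsGaussCode code
  spherical : Nat.card (Region code) = code.length / 2 + 2

/-- The word `x y` or `y x`: a strand that passes `x` and `y` in this or in the opposite order. -/
def strand (ε : ℤˣ) (x y : Passage) : List Passage := if ε = 1 then [x, y] else [y, x]

/-- Elementary changes of a signed Gauss code: change of the starting point, names of the
crossings, or orientation, and the three Reidemeister moves.
In the third move a triangle has vertices `a` (top over middle strand), `b` (top over bottom
strand) and `c` (middle over bottom strand); each of the strands meets its two vertices in
one of the two orders `εT`, `εM`, `εB`, and `θ` is the orientation of the triangle `a b c`. -/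
inductive Move : List Passage → List Passage → Prop
  | rotate (u v : List Passage) : Move (u ++ v) (v ++ u)
  | rename (f : Equiv.Perm ℕ) (w : List Passage) : Move w (w.map (Passage.rename f))
  | reverse (w : List Passage) : Move w w.reverse
  | reidemeister1 (w : List Passage) (x : Passage) : Move ([x, x.partner] ++ w) w
  | reidemeister2 (u v : List Passage) (a b : ℕ) (s ε : ℤˣ) :
      Move ([⟨a, true, s⟩, ⟨b, true, -s⟩] ++ u ++ strand ε ⟨a, false, s⟩ ⟨b, false, -s⟩ ++ v)
        (u ++ v)
  | reidemeister3 (u v w T M B : List Passage) (a b c : ℕ) (εT εM εB θ : ℤˣ)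
      (hT : T = strand εT ⟨a, true, εT * εM * θ⟩ ⟨b, true, εT * εB * θ⟩)
      (hM : M = strand εM ⟨a, false, εT * εM * θ⟩ ⟨c, true, εM * εB * θ⟩)
      (hB : B = strand εB ⟨b, false, εT * εB * θ⟩ ⟨c, false, εM * εB * θ⟩) :
      Move (T ++ u ++ M ++ v ++ B ++ w) (T.reverse ++ u ++ M.reverse ++ v ++ B.reverse ++ w)
  | reidemeister3' (u v w T M B : List Passage) (a b c : ℕ) (εT εM εB θ : ℤˣ)
      (hT : T = strand εT ⟨a, true, εT * εM * θ⟩ ⟨b, true, εT * εB * θ⟩)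
      (hM : M = strand εM ⟨a, false, εT * εM * θ⟩ ⟨c, true, εM * εB * θ⟩)
      (hB : B = strand εB ⟨b, false, εT * εB * θ⟩ ⟨c, false, εM * εB * θ⟩) :
      Move (T ++ u ++ B ++ v ++ M ++ w) (T.reverse ++ u ++ B.reverse ++ v ++ M.reverse ++ w)

/-- Two knot diagrams are equivalent if they are related by a finite sequence of moves between
knot diagrams. -/
def KnotDiagram.setoid : Setoid KnotDiagram :=
  Relation.EqvGen.setoid fun D D' => Move D.code D'.code

/-- A knot: an equivalence class of knot diagrams. -/
def Knot : Type := Quotient KnotDiagram.setoid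

/-- `D` is a diagram of the knot `K`. -/
def KnotDiagram.IsDiagramOf (D : KnotDiagram) (K : Knot) : Prop :=
  Quotient.mk KnotDiagram.setoid D = K

namespace KnotDiagram

variable (D : KnotDiagram)

/-- The front left region around the crossing with over-passage `i`. Of the four regions there, the
over-strand separates left from right, and the under-strand separates front from back. -/
def frontLeft (i : Fin D.code.length) : Region D.code := .beside (outArc D.code i) .left

/-- The front right region around the crossing with over-passage `i`. -/
def frontRight (i : Fin D.code.length) : Region D.code := .beside (outArc D.code i) .right

/-- The back left region around the crossing with over-passage `i`. -/
def backLeft (i : Fin D.code.length) : Region D.code := .beside (inArc D.code i) .left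

/-- The back right region around the crossing with over-passage `i`. -/
def backRight (i : Fin D.code.length) : Region D.code := .beside (inArc D.code i) .right

/-- `C` is a Dehn `p`-coloring: at each crossing `C x₁ + C x₃ = C x₂ + C x₄`, where the region `x₁`
is separated from `x₂` by the under-strand and from `x₃` by the over-strand, and `x₄` is opposite
to `x₁`. -/
def IsDehnColoring (p : ℕ) (C : Region D.code → ZMod p) : Prop :=
  ∀ i : Fin D.code.length, (D.code.get i).isOver = true →
    C (D.frontLeft i) + C (D.frontRight i) = C (D.backLeft i) + C (D.backRight i)

/-- A coloring is trivial if at each crossing opposite regions have equal colors. -/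
def IsTrivialColoring (p : ℕ) (C : Region D.code → ZMod p) : Prop :=
  ∀ i : Fin D.code.length, (D.code.get i).isOver = true →
    C (D.frontLeft i) = C (D.backRight i) ∧ C (D.frontRight i) = C (D.backLeft i)

end KnotDiagram

/-- `C` makes `D` a nontrivially Dehn `p`-colored diagram of `K`. -/
def IsNontrivialDehnColoredDiagram (p : ℕ) (K : Knot) (D : KnotDiagram)
    (C : Region D.code → ZMod p) : Prop :=
  D.IsDiagramOf K ∧ D.IsDehnColoring p C ∧ ¬ D.IsTrivialColoring p C

/-- `K` has a nontrivially Dehn `p`-colored diagram. -/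
def Knot.DehnColorable (p : ℕ) (K : Knot) : Prop :=
  ∃ (D : KnotDiagram) (C : Region D.code → ZMod p), IsNontrivialDehnColoredDiagram p K D C

/-- The minimum number of colors of `K` for Dehn `p`-colorings: the least number of colors used by
a nontrivially Dehn `p`-colored diagram of `K`. -/
noncomputable def mincolDehn (p : ℕ) (K : Knot) : ℕ :=
  sInf {m : ℕ | ∃ (D : KnotDiagram) (C : Region D.code → ZMod p),
    IsNontrivialDehnColoredDiagram p K D C ∧ (Set.range C).ncard = m}

/-! Let a nontrivial coloring use `m` colors. The crossing relations, read with one unknown per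
color, form an integer linear system; modulo `p` the colors themselves solve it, and so do their
differences from a fixed color. Modulo 2, a solution composed with `C` is a Dehn 2-coloring, hence
constant or a checkerboard. Setting one unknown to zero kills the constants. If a checkerboard
factors through `C`, a second unknown, for a color of the other class, is set to zero, and the
solution modulo `p` is corrected by a checkerboard so that it vanishes there too; it stays nonzero
because `C` is nontrivial. The reduced system, with at most `m - 1` unknowns, then has trivial
kernel modulo 2 but not modulo `p`. So some maximal minor is odd, hence nonzero, and divisible by
`p`. Each row is a sum of two incidence rows, which bounds the minor by `2 ^ (m - 1)`
(`abs_det_sum_incidence_le`). Thus `p ≤ 2 ^ (m - 1)`, strictly since `p` is odd. -/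

/-! ### Determinants of sums of incidence matrices -/

open Matrix in
/-- A square submatrix of the incidence matrix of a directed graph has determinant at most one in
absolute value. -/
theorem abs_det_incidence_le_one {σ : Type*} [DecidableEq σ] {n : ℕ} (φ : Fin n → σ)
    (hφ : Function.Injective φ) (a b : Fin n → σ) :
    |det (of fun i j => (if φ j = a i then 1 else 0) - (if φ j = b i then 1 else 0) :
      Matrix (Fin n) (Fin n) ℤ)| ≤ 1 := by
  induction n with
  | zero => simp
  | succ n ih =>
    set A : Matrix (Fin (n + 1)) (Fin (n + 1)) ℤ :=
      of fun i j => (if φ j = a i then 1 else 0) - (if φ j = b i then 1 else 0) with hA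
    by_cases hrow : ∀ i, (a i ∈ Set.range φ ↔ b i ∈ Set.range φ)
    · have hcount (c : σ) : ∑ j, (if φ j = c then (1 : ℤ) else 0) =
          if c ∈ Set.range φ then 1 else 0 := by
        split_ifs with h
        · obtain ⟨k, rfl⟩ := h
          simp [hφ.eq_iff]
        · exact Finset.sum_eq_zero fun j _ => if_neg fun hj => h ⟨j, hj⟩
      -- Every row contains both of its endpoints or neither among the columns, so its entries sum
      -- to zero.
      have hdet : A.det = 0 := by
        refine exists_mulVec_eq_zero_iff.mp ⟨fun _ => 1, fun h => one_ne_zero (congrFun h 0), ?_⟩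
        ext i
        simp only [mulVec, dotProduct, hA, of_apply, mul_one, Finset.sum_sub_distrib, hcount,
          Pi.zero_apply]
        rw [if_congr (hrow i) rfl rfl, sub_self]
      simp [hdet]
    · push Not at hrow
      obtain ⟨i, hi⟩ := hrow
      -- Exactly one endpoint of row `i` is a column, so Laplace expansion along this row leaves a
      -- single minor.
      have hsingle : ∃ j₀, (∀ j, j ≠ j₀ → A i j = 0) ∧ |A i j₀| ≤ 1 := by
        rcases hi with ⟨⟨j₀, hj₀⟩, hb⟩ | ⟨ha, ⟨j₀, hj₀⟩⟩
        · have hb' (j) : φ j ≠ b i := fun h => hb ⟨j, h⟩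
          refine ⟨j₀, fun j hj => ?_, ?_⟩
          · simp [hA, ← hj₀, hφ.eq_iff, hj, hb' j]
          · simp [hA, hj₀, hj₀ ▸ hb' j₀]
        · have ha' (j) : φ j ≠ a i := fun h => ha ⟨j, h⟩
          refine ⟨j₀, fun j hj => ?_, ?_⟩
          · simp [hA, ← hj₀, hφ.eq_iff, hj, ha' j]
          · simp [hA, hj₀, hj₀ ▸ ha' j₀]
      obtain ⟨j₀, hzero, hle⟩ := hsingle
      rw [det_succ_row A i, Finset.sum_eq_single j₀ (fun j _ hj => by simp [hzero j hj]) (by simp),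
        abs_mul, abs_mul, abs_pow, abs_neg, abs_one, one_pow, one_mul]
      exact mul_le_one₀ hle (abs_nonneg _)
        (ih (φ ∘ j₀.succAbove) (hφ.comp Fin.succAbove_right_injective) (a ∘ i.succAbove)
          (b ∘ i.succAbove))

open Matrix in
-- Multilinearity in the rows expands the determinant into `2 ^ Fintype.card τ` incidence
-- determinants, each at most one in absolute value.
theorem abs_det_sum_incidence_le {σ τ : Type*} [DecidableEq σ] [Fintype τ] [DecidableEq τ]
    (φ : τ → σ) (hφ : Function.Injective φ) (a b c d : τ → σ) :
    |det (of fun i j => ((if φ j = a i then 1 else 0) - (if φ j = b i then 1 else 0)) +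
        ((if φ j = c i then 1 else 0) - (if φ j = d i then 1 else 0)) : Matrix τ τ ℤ)| ≤
      2 ^ Fintype.card τ := by
  have hinc (a b : τ → σ) : |det (of fun i j => (if φ j = a i then 1 else 0) -
      (if φ j = b i then 1 else 0) : Matrix τ τ ℤ)| ≤ 1 := by
    let e := (Fintype.equivFin τ).symm
    rw [← det_submatrix_equiv_self e]
    exact abs_det_incidence_le_one (φ ∘ e) (hφ.comp e.injective) (a ∘ e) (b ∘ e)
  have hsplit := (detRowAlternating (n := τ) (R := ℤ)).toMultilinearMap.map_add_univ
    (fun i j => (if φ j = a i then 1 else 0) - (if φ j = b i then 1 else 0))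
    (fun i j => (if φ j = c i then 1 else 0) - (if φ j = d i then 1 else 0))
  calc _ = |∑ s : Finset τ, det (of fun i j =>
        (if φ j = s.piecewise a c i then 1 else 0) -
          (if φ j = s.piecewise b d i then 1 else 0) : Matrix τ τ ℤ)| := by
        refine congrArg _ (hsplit.trans (Finset.sum_congr rfl fun s _ => ?_))
        refine congrArg det ?_
        ext i j
        by_cases hi : i ∈ s <;> simp [Finset.piecewise, hi]
    _ ≤ ∑ s : Finset τ, 1 := (Finset.abs_sum_le_sum_abs _ _).trans
        (Finset.sum_le_sum fun s _ => hinc _ _)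
    _ = _ := by simp

open Matrix in
/-- A matrix with trivial kernel has an invertible maximal square submatrix. -/
theorem exists_submatrix_det_ne_zero {K ι τ : Type*} [Field K] [Fintype τ] [DecidableEq τ]
    [Finite ι] (M : Matrix ι τ K) (hM : ∀ y, M *ᵥ y = 0 → y = 0) :
    ∃ f : τ → ι, (M.submatrix f id).det ≠ 0 := by
  have := Fintype.ofFinite ι
  have hrank : M.rank = Fintype.card τ := by
    have hinj : Function.Injective M.mulVecLin :=
      (injective_iff_map_eq_zero M.mulVecLin).mpr hM
    rw [rank, LinearMap.finrank_range_of_inj hinj, Module.finrank_fintype_fun_eq_card]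
  obtain ⟨κ, f, hf, hspan, hli⟩ := exists_linearIndependent' K M.row
  have := Finite.of_injective f hf
  have := Fintype.ofFinite κ
  have hcard : Fintype.card κ = Fintype.card τ := by
    rw [← hrank, rank_eq_finrank_span_row, ← hspan, ← finrank_span_eq_card hli]
  let e : τ ≃ κ := Fintype.equivOfCardEq hcard.symm
  refine ⟨f ∘ e, ?_⟩
  have hrows : LinearIndependent K (M.submatrix (f ∘ e) id).row := hli.comp e e.injective
  exact ((isUnit_iff_isUnit_det _).mp (linearIndependent_rows_iff_isUnit.mp hrows)).ne_zero

open Matrix in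
/-- If a system of equations `x (a i) + x (c i) = x (b i) + x (d i)` with unknowns indexed by `T`
has only the zero solution modulo `2` but has a nonzero solution modulo `p`, then
`p ≤ 2 ^ T.card`. -/
theorem le_two_pow_card_of_solution {σ ι : Type*} [DecidableEq σ] [Finite ι] (a b c d : ι → σ)
    (T : Finset σ) {p : ℕ} [Fact p.Prime] (x : σ → ZMod p)
    (hx : ∀ i, x (a i) + x (c i) = x (b i) + x (d i)) (hxT : ∀ s ∉ T, x s = 0) (hx0 : x ≠ 0)
    (hy : ∀ y : σ → ZMod 2, (∀ i, y (a i) + y (c i) = y (b i) + y (d i)) →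
      (∀ s ∉ T, y s = 0) → y = 0) :
    p ≤ 2 ^ T.card := by
  let M : Matrix ι T ℤ := of fun i j =>
    ((if (j : σ) = a i then 1 else 0) - (if (j : σ) = b i then 1 else 0)) +
      ((if (j : σ) = c i then 1 else 0) - (if (j : σ) = d i then 1 else 0))
  have hsum {R : Type} [CommRing R] (y : σ → R) (hyT : ∀ s ∉ T, y s = 0) (s : σ) :
      ∑ j : T, (if (j : σ) = s then (1 : R) else 0) * y j = y s := by
    rw [Finset.sum_coe_sort T (fun j => (if j = s then (1 : R) else 0) * y j)]
    by_cases hs : s ∈ T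
    · simp [hs]
    · simp [hs, hyT s hs]
  have hmul {R : Type} [CommRing R] (y : σ → R) (hyT : ∀ s ∉ T, y s = 0) (i : ι) :
      (M.map (Int.cast : ℤ → R) *ᵥ fun j : T => y j) i =
        (y (a i) - y (b i)) + (y (c i) - y (d i)) := by
    simp only [mulVec, dotProduct, map_apply, M, of_apply, Int.cast_add, Int.cast_sub,
      Int.cast_ite, Int.cast_one, Int.cast_zero, add_mul, sub_mul, Finset.sum_add_distrib,
      Finset.sum_sub_distrib, hsum y hyT]
  have hker (z : T → ZMod 2) (hz : M.map (Int.cast : ℤ → ZMod 2) *ᵥ z = 0) : z = 0 := by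
    let y : σ → ZMod 2 := fun s => if h : s ∈ T then z ⟨s, h⟩ else 0
    have hyT (s) (hs : s ∉ T) : y s = 0 := dif_neg hs
    have hyz : (fun j : T => y j) = z := by
      ext j
      simp [y]
    have hy0 : y = 0 := by
      refine hy y (fun i => ?_) hyT
      have := hmul y hyT i
      rw [hyz, hz, Pi.zero_apply] at this
      linear_combination -this
    rw [← hyz, hy0]
    rfl
  obtain ⟨f, hf⟩ := exists_submatrix_det_ne_zero _ hker
  set N : Matrix T T ℤ := M.submatrix f id with hN
  have hdet (q : ℕ) : (M.map (Int.cast : ℤ → ZMod q)).submatrix f id =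
      (Int.castRingHom (ZMod q)).mapMatrix N := rfl
  -- The minor is nonzero modulo 2, so it is nonzero as an integer.
  have hne : N.det ≠ 0 := by
    intro h
    rw [hdet 2, ← RingHom.map_det, h, map_zero] at hf
    exact hf rfl
  have hdvd : (p : ℤ) ∣ N.det := by
    rw [← ZMod.intCast_zmod_eq_zero_iff_dvd N.det p, ← eq_intCast (Int.castRingHom (ZMod p)),
      RingHom.map_det, ← hdet p, ← exists_mulVec_eq_zero_iff]
    refine ⟨fun j => x j, fun h => hx0 ?_, ?_⟩
    · ext s
      by_cases hs : s ∈ T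
      · exact congrFun h ⟨s, hs⟩
      · exact hxT s hs
    · ext i
      refine (hmul x hxT (f i)).trans ?_
      rw [Pi.zero_apply]
      linear_combination hx (f i)
  have hle : |N.det| ≤ 2 ^ T.card := by
    rw [← Fintype.card_coe T]
    exact abs_det_sum_incidence_le (Subtype.val : T → σ) Subtype.val_injective
      (a ∘ f) (b ∘ f) (c ∘ f) (d ∘ f)
  have := (Int.le_of_dvd (abs_pos.mpr hne) ((dvd_abs _ _).mpr hdvd)).trans hle
  exact_mod_cast this

/-! ### Semiarcs and regions around a crossing -/

theorem IsGaussCode.exists_isCrossing {w : List Passage} (hw : IsGaussCode w)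
    (k : Fin w.length) : ∃ i j, IsCrossing w i j ∧ (k = i ∨ k = j) := by
  obtain ⟨l, hl⟩ := List.mem_iff_get.mp (hw.partner_mem _ (List.get_mem w k))
  cases hk : (w.get k).isOver with
  | true => exact ⟨k, l, ⟨hk, hl⟩, .inl rfl⟩
  | false =>
    refine ⟨l, k, ⟨?_, ?_⟩, .inr rfl⟩
    · rw [hl, Passage.partner, hk]
      rfl
    · rw [hl]
      simp [Passage.partner]

/-- The curve is a single closed strand, so following it from semiarc `0` reaches all the others. -/
theorem Semiarc.induction {w : List Passage} {P : Semiarc w → Prop} (h₀ : P ⟨0, by simp⟩)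
    (hstep : ∀ i : Fin w.length, P (inArc w i) → P (outArc w i)) (e : Semiarc w) : P e := by
  obtain ⟨k, hk⟩ := e
  induction k with
  | zero => exact h₀
  | succ k ih =>
    have hlen : k < w.length := by omega
    have hout : outArc w ⟨k, hlen⟩ = ⟨k + 1, hk⟩ := Fin.ext (Nat.mod_eq_of_lt hk)
    exact hout ▸ hstep ⟨k, hlen⟩ (ih (by omega))

theorem Region.exists_beside {w : List Passage} (r : Region w) : ∃ e s, r = .beside e s := by
  induction r using Quot.ind with
  | mk x => exact ⟨x.1, x.2, rfl⟩

instance : Finite Side := Finite.of_injective (β := Bool) (fun s => decide (s = .left))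
  (by rintro ⟨⟩ ⟨⟩ <;> simp)

instance (w : List Passage) : Finite (Region w) := Quot.finite _

/-- The four quadrants of a crossing, read from the under-strand: one of the two sides of the
under-strand meets the two left quadrants and the other the two right quadrants. -/
theorem IsCrossing.beside_eq {w : List Passage} {i j : Fin w.length} (h : IsCrossing w i j) :
    ∃ e e' : Semiarc w, ((e = inArc w j ∧ e' = outArc w j) ∨ (e = outArc w j ∧ e' = inArc w j)) ∧
      ∃ s s' : Side, s ≠ s' ∧
      Region.beside (outArc w i) .left = .beside e s ∧
      Region.beside (inArc w i) .left = .beside e s' ∧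
      Region.beside (outArc w i) .right = .beside e' s ∧
      Region.beside (inArc w i) .right = .beside e' s' := by
  have h₁ := Quot.sound (SameQuadrant.frontLeft i j h)
  have h₂ := Quot.sound (SameQuadrant.frontRight i j h)
  have h₃ := Quot.sound (SameQuadrant.backLeft i j h)
  have h₄ := Quot.sound (SameQuadrant.backRight i j h)
  by_cases hs : (w.get i).sign = 1
  · rw [if_pos hs] at h₁ h₂ h₃ h₄
    exact ⟨_, _, .inr ⟨rfl, rfl⟩, .right, .left, by simp, h₁, h₃, h₂, h₄⟩
  · rw [if_neg hs] at h₁ h₂ h₃ h₄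
    exact ⟨_, _, .inl ⟨rfl, rfl⟩, .left, .right, by simp, h₁, h₃, h₂, h₄⟩

/-! ### Dehn colorings modulo 2 -/

namespace KnotDiagram

variable {D : KnotDiagram}

/-- A Dehn `2`-coloring changes by the same amount across all semiarcs. -/
theorem IsDehnColoring.exists_add_eq {g : Region D.code → ZMod 2} (hg : D.IsDehnColoring 2 g) :
    ∃ f, ∀ e, g (.beside e .left) + g (.beside e .right) = f := by
  refine ⟨_, Semiarc.induction rfl fun k hk => hk ▸ ?_⟩
  obtain ⟨i, j, hij, hkij⟩ := D.isGaussCode.exists_isCrossing k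
  have hrel := hg i hij.1
  rcases hkij with rfl | rfl
  · exact hrel
  · obtain ⟨e, e', he, s, s', hs, h₁, h₂, h₃, h₄⟩ := hij.beside_eq
    simp only [frontLeft, frontRight, backLeft, backRight, h₁, h₂, h₃, h₄] at hrel
    -- Signs do not matter modulo 2, so the relation across the over-strand can be regrouped as one
    -- across the under-strand.
    have key : g (.beside e s) + g (.beside e s') = g (.beside e' s) + g (.beside e' s') := by
      generalize g (.beside e s) = x₁ at *
      generalize g (.beside e s') = x₂ at *
      generalize g (.beside e' s) = x₃ at *
      generalize g (.beside e' s') = x₄ at *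
      revert x₁ x₂ x₃ x₄
      decide
    rcases he with ⟨rfl, rfl⟩ | ⟨rfl, rfl⟩ <;> cases s <;> cases s' <;>
      first
      | exact absurd rfl hs
      | linear_combination key
      | linear_combination -key

/-- All four quadrants at a crossing get the same value, so the value is carried unchanged along the
curve. -/
theorem eq_of_forall_left_eq_right {α : Type*} {g : Region D.code → α}
    (hg : ∀ e, g (.beside e .left) = g (.beside e .right)) (r r' : Region D.code) :
    g r = g r' := by
  have hleft : ∀ e, g (.beside e .left) = g (.beside ⟨0, by simp⟩ .left) := by
    refine Semiarc.induction rfl fun k hk => hk ▸ ?_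
    obtain ⟨i, j, hij, hkij⟩ := D.isGaussCode.exists_isCrossing k
    obtain ⟨e, e', he, s, s', hs, h₁, h₂, h₃, h₄⟩ := hij.beside_eq
    have hside (e : Semiarc D.code) (s s' : Side) : g (.beside e s) = g (.beside e s') := by
      cases s <;> cases s' <;> simp [hg e]
    have hi : g (.beside (outArc D.code i) .left) = g (.beside (inArc D.code i) .left) := by
      rw [h₁, h₂, hside]
    have hj : g (.beside e .left) = g (.beside e' .left) := by
      rw [hside e _ s, ← h₁, hside (outArc D.code i) _ .right, h₃, hside]
    rcases hkij with rfl | rfl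
    · exact hi
    · rcases he with ⟨rfl, rfl⟩ | ⟨rfl, rfl⟩
      · exact hj.symm
      · exact hj
  have hbase (r : Region D.code) : g r = g (.beside ⟨0, by simp⟩ .left) := by
    obtain ⟨e, s, rfl⟩ := r.exists_beside
    cases s
    · exact hleft e
    · exact (hg e).symm.trans (hleft e)
  rw [hbase r, hbase r']

/-- A Dehn `2`-coloring is constant or takes different values on the two sides of each semiarc. -/
theorem IsDehnColoring.constant_or_checkerboard {g : Region D.code → ZMod 2}
    (hg : D.IsDehnColoring 2 g) :
    (∀ r r', g r = g r') ∨ ∀ e, g (.beside e .left) + g (.beside e .right) = 1 := by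
  obtain ⟨f, hf⟩ := hg.exists_add_eq
  have : f = 0 ∨ f = 1 := by
    clear hf
    revert f
    decide
  rcases this with rfl | rfl
  · exact .inl (eq_of_forall_left_eq_right fun e => CharTwo.add_eq_zero.mp (hf e))
  · exact .inr hf

/-- A checkerboard coloring of the regions takes equal values on opposite regions at a crossing
and different values on adjacent ones. -/
theorem checkerboard_at_crossing {g : Region D.code → ZMod 2}
    (hg : ∀ e, g (.beside e .left) + g (.beside e .right) = 1) (i : Fin D.code.length)
    (hi : (D.code.get i).isOver = true) :
    g (D.frontLeft i) = g (D.backRight i) ∧ g (D.frontRight i) = g (D.backLeft i) := by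
  obtain ⟨l, hl⟩ := List.mem_iff_get.mp (D.isGaussCode.partner_mem _ (List.get_mem D.code i))
  obtain ⟨e, e', -, s, s', hs, h₁, h₂, -, -⟩ := IsCrossing.beside_eq ⟨hi, hl⟩
  have hout := hg (outArc D.code i)
  have hin := hg (inArc D.code i)
  have hcross : g (D.frontLeft i) + g (D.backLeft i) = 1 := by
    rw [frontLeft, backLeft, h₁, h₂, ← hg e]
    cases s <;> cases s' <;> first | exact absurd rfl hs | ring
  change g (D.frontLeft i) + g (D.frontRight i) = 1 at hout
  change g (D.backLeft i) + g (D.backRight i) = 1 at hin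
  constructor
  · linear_combination hcross - hin
  · linear_combination hout - hcross

/-! ### The bound on the number of colors -/

/-- The number of colors of a nontrivial Dehn `p`-coloring is more than `log₂ p`. -/
theorem IsDehnColoring.le_two_pow {p : ℕ} (hp : p.Prime) {C : Region D.code → ZMod p}
    (hC : D.IsDehnColoring p C) (hnt : ¬ D.IsTrivialColoring p C) :
    p ≤ 2 ^ ((Set.range C).ncard - 1) := by
  classical
  have : Fact p.Prime := ⟨hp⟩
  have bound (T : Finset (ZMod p)) (r₀ : Region D.code) (hT : ↑T ⊆ Set.range C \ {C r₀})
      (x : ZMod p → ZMod p) (hx : D.IsDehnColoring p (x ∘ C)) (hxT : ∀ s ∉ T, x s = 0)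
      (hx0 : x ≠ 0)
      (hy : ∀ y : ZMod p → ZMod 2, D.IsDehnColoring 2 (y ∘ C) → (∀ s ∉ T, y s = 0) → y = 0) :
      p ≤ 2 ^ ((Set.range C).ncard - 1) := by
    let I := {i : Fin D.code.length // (D.code.get i).isOver = true}
    refine (le_two_pow_card_of_solution (ι := I) (fun i => C (D.frontLeft i))
      (fun i => C (D.backLeft i)) (fun i => C (D.frontRight i)) (fun i => C (D.backRight i)) T x
      (fun i => hx i i.2) hxT hx0 fun y h => hy y fun i hi => h ⟨i, hi⟩).trans ?_
    refine Nat.pow_le_pow_right two_pos ?_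
    rw [← Set.ncard_sdiff_singleton_of_mem (Set.mem_range_self r₀), ← Set.ncard_coe_finset]
    exact Set.ncard_le_ncard hT (Set.toFinite _)
  let r₀ : Region D.code := .beside ⟨0, by simp⟩ .left
  let r₁ : Region D.code := .beside ⟨0, by simp⟩ .right
  -- A checkerboard that depends only on the color is an extra solution modulo 2; it decides whether
  -- two colors or one must be normalized to zero.
  by_cases hcheck : ∃ h : ZMod p → ZMod 2,
      ∀ e, h (C (.beside e .left)) + h (C (.beside e .right)) = 1
  · obtain ⟨h, hh⟩ := hcheck
    have h01 : h (C r₀) ≠ h (C r₁) := by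
      intro h'
      have := hh ⟨0, by simp⟩
      change h (C r₀) + h (C r₁) = 1 at this
      rw [h', CharTwo.add_self_eq_zero] at this
      exact zero_ne_one this
    -- `t` picks one representative color per checkerboard class. Opposite regions share a class, so
    -- subtracting `t ∘ h` preserves the crossing relations.
    let t : ZMod 2 → ZMod p := fun v => if v = h (C r₀) then C r₀ else C r₁
    have ht₀ : t (h (C r₀)) = C r₀ := if_pos rfl
    have ht₁ : t (h (C r₁)) = C r₁ := if_neg h01.symm
    let T : Finset (ZMod p) := (Set.toFinite (Set.range C \ {C r₀, C r₁})).toFinset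
    have hmemT (s : ZMod p) : s ∈ T ↔ s ∈ Set.range C ∧ s ≠ C r₀ ∧ s ≠ C r₁ := by
      simp [T]
    have hopp := checkerboard_at_crossing (g := h ∘ C) hh
    let x : ZMod p → ZMod p := fun s => if s ∈ Set.range C then s - t (h s) else 0
    have hxC (r) : x (C r) = C r - t (h (C r)) := if_pos ⟨r, rfl⟩
    refine bound T r₀ ?_ x ?_ ?_ ?_ ?_
    · intro s hs
      exact ⟨((hmemT s).mp hs).1, ((hmemT s).mp hs).2.1⟩
    · intro i hi
      obtain ⟨ho₁, ho₂⟩ := hopp i hi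
      simp only [Function.comp_apply] at ho₁ ho₂
      simp only [Function.comp_apply, hxC, ho₁, ho₂]
      linear_combination hC i hi
    · intro s hs
      by_cases hsC : s ∈ Set.range C
      · by_cases h₀ : s = C r₀
        · rw [h₀, hxC, ht₀, sub_self]
        · have h₁ : s = C r₁ := by
            by_contra h₁
            exact hs ((hmemT s).mpr ⟨hsC, h₀, h₁⟩)
          rw [h₁, hxC, ht₁, sub_self]
      · exact if_neg hsC
    · intro hx0
      -- If `x = 0`, the color is determined by the checkerboard class, so opposite regions agree
      -- and `C` is trivial.
      refine hnt fun i hi => ?_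
      obtain ⟨ho₁, ho₂⟩ := hopp i hi
      have hfac (r) : C r = t (h (C r)) := by
        have := hxC r
        rw [hx0, Pi.zero_apply] at this
        exact (sub_eq_zero.mp this.symm)
      exact ⟨(hfac _).trans ((congrArg t ho₁).trans (hfac _).symm),
        (hfac _).trans ((congrArg t ho₂).trans (hfac _).symm)⟩
    · intro y hy hyT
      have hy₀ : y (C r₀) = 0 := hyT _ fun hs => ((hmemT _).mp hs).2.1 rfl
      have hy₁ : y (C r₁) = 0 := hyT _ fun hs => ((hmemT _).mp hs).2.2 rfl
      ext s
      by_cases hs : s ∈ T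
      · obtain ⟨r, rfl⟩ := ((hmemT s).mp hs).1
        rcases hy.constant_or_checkerboard with hconst | hne
        · exact (hconst r r₀).trans hy₀
        · have : y (C r₀) + y (C r₁) = 1 := hne ⟨0, by simp⟩
          rw [hy₀, hy₁, add_zero] at this
          exact absurd this zero_ne_one
      · exact hyT s hs
  · let T : Finset (ZMod p) := (Set.toFinite (Set.range C \ {C r₀})).toFinset
    have hmemT (s : ZMod p) : s ∈ T ↔ s ∈ Set.range C ∧ s ≠ C r₀ := by
      simp [T]
    let x : ZMod p → ZMod p := fun s => if s ∈ Set.range C then s - C r₀ else 0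
    have hxC (r) : x (C r) = C r - C r₀ := if_pos ⟨r, rfl⟩
    refine bound T r₀ ?_ x ?_ ?_ ?_ ?_
    · intro s hs
      exact (hmemT s).mp hs
    · intro i hi
      simp only [Function.comp_apply, hxC]
      linear_combination hC i hi
    · intro s hs
      by_cases hsC : s ∈ Set.range C
      · have h₀ : s = C r₀ := by
          by_contra h₀
          exact hs ((hmemT s).mpr ⟨hsC, h₀⟩)
        rw [h₀, hxC, sub_self]
      · exact if_neg hsC
    · intro hx0
      have hconst (r) : C r = C r₀ := by
        have := hxC r
        rw [hx0, Pi.zero_apply] at this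
        exact sub_eq_zero.mp this.symm
      exact hnt fun i _ => by simp only [hconst, and_self]
    · intro y hy hyT
      have hy₀ : y (C r₀) = 0 := hyT _ fun hs => ((hmemT _).mp hs).2 rfl
      ext s
      by_cases hs : s ∈ T
      · obtain ⟨r, rfl⟩ := ((hmemT s).mp hs).1
        rcases hy.constant_or_checkerboard with hconst | hne
        · exact (hconst r r₀).trans hy₀
        · exact absurd ⟨y, hne⟩ hcheck
      · exact hyT s hs

end KnotDiagram

theorem mainTheorem1 (p : ℕ) (hp : p.Prime) (hodd : Odd p) (K : Knot)
    (hK : K.DehnColorable p) :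
    Real.logb 2 (p : ℝ) + 1 ≤ (mincolDehn p K : ℝ) ∧
      ⌊Real.logb 2 (p : ℝ)⌋ + 2 ≤ (mincolDehn p K : ℤ) := by
  obtain ⟨D, C, ⟨-, hC, hnt⟩, hm⟩ : mincolDehn p K ∈ {m : ℕ | ∃ (D : KnotDiagram)
      (C : Region D.code → ZMod p),
      IsNontrivialDehnColoredDiagram p K D C ∧ (Set.range C).ncard = m} := by
    obtain ⟨D, C, h⟩ := hK
    exact Nat.sInf_mem ⟨_, D, C, h, rfl⟩
  have hle := hC.le_two_pow hp hnt
  have hpos : 0 < (Set.range C).ncard :=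
    (Set.ncard_pos (Set.toFinite _)).mpr ⟨_, .beside ⟨0, by simp⟩ .left, rfl⟩
  obtain ⟨k, hk⟩ := Nat.exists_eq_add_of_lt hpos
  rw [hm] at hk hle
  rw [zero_add] at hk
  rw [hk, Nat.add_sub_cancel] at hle
  have hp0 : (0 : ℝ) < p := by exact_mod_cast hp.pos
  -- An odd prime is not a power of two. Strictness is what gains the last unit in the floor form.
  have hlt : p < 2 ^ k := by
    refine lt_of_le_of_ne hle fun h => ?_
    have hk1 : k ≠ 0 := by
      rintro rfl
      exact hp.one_lt.ne' h
    rw [h] at hodd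
    exact (Nat.not_even_iff_odd.mpr hodd) ((Nat.even_pow' hk1).mpr even_two)
  have hlog : Real.logb 2 (p : ℝ) < k := by
    rw [Real.logb_lt_iff_lt_rpow one_lt_two hp0, Real.rpow_natCast]
    exact_mod_cast hlt
  have hfloor : ⌊Real.logb 2 (p : ℝ)⌋ < (k : ℤ) := Int.floor_lt.mpr (by exact_mod_cast hlog)
  rw [hk]
  push_cast
  exact ⟨by linarith, by omega⟩
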